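/- Let $\mathcal X,\mathcal Y$ be Polish spaces, let $\mu\in\mathscr P(\mathcal X)$ be atomless, and let $c:\mathcal X\times\mathcal Y\to[0,+\infty]$, $L:\mathcal Y\to[0,+\infty]$, $H:\mathcal Y\times\mathcal Y\to[0,+\infty]$ be lower semicontinuous, with $H$ symmetric and $\{L\le\kappa\}$ compact for every $\kappa>0$. For $\nu,\nu'\in\mathscr P(\mathcal Y)$ put $\mathcal L(\nu)=\int L\,d\nu$ and $\mathcal H(\nu,\nu')=\int H\,d(\nu\otimes\nu')$. For $\rho\in\mathscr P(\mathcal X)$ let $\mathscr P_\rho(\mathcal X\times\mathcal Y)$ be the set of $\gamma\in\mathscr P(\mathcal X\times\mathcal Y)$ with first marginal $\rho$. Define $\mathcal J:\mathscr P(\mathcal X\times\mathcal Y)\to[0,+\infty]$ by $$\mathcal J(\gamma)=\int c\,d\gamma+\mathcal L(\nu)+\mathcal H(\nu,\nu)\quad\text{if }\gamma\in\mathscr P_\mu(\mathcal X\times\mathcal Y)\text{ has second marginal }\nu,\qquad \mathcal J(\gamma)=+\infty\text{ otherwise.}$$ Let $(X_i)_{i\ge1}$ be i.i.d. random variables with law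 $\mu$ on a probability space $(\Omega,\mathcal F,\mathbb P)$, and write $x_i=X_i(\omega)$ and $\mu_N=\mu_N(\omega)=\frac1N\sum_{i=1}^N\delta_{x_i}$. Almost surely the $x_i$ are pairwise distinct, and then every $\gamma_N\in\mathscr P_{\mu_N}(\mathcal X\times\mathcal Y)$ is uniquely of the form $\gamma_N=\frac1N\sum_{i=1}^N\delta_{x_i}\otimes\nu_i$ with $\nu_i\in\mathscr P(\mathcal Y)$. Define the mixed-strategy potential by $$\mathcal J_{\omega,N}(\gamma_N)=\int c\,d\gamma_N+\frac1N\sum_{i=1}^N\mathcal L(\nu_i)+\frac1{N^2}\sum_{i\ne j}\mathcal H(\nu_i,\nu_j)\quad\text{if }\gamma_N\in\mathscr P_{\mu_N}(\mathcal X\times\mathcal Y),$$ and $\mathcal J_{\omega,N}(\gamma_N)=+\infty$ otherwise, and the pure-strategy potential by $J_{\omega,N}(y_1,\dots,y_N)=\mathcal J_{\omega,N}\big(\frac1N\sum_{i=1}^N\delta_{(x_i,y_i)}\big)$. The latter is regarded as a functional on $\mathscr P(\mathcal X\times\mathcal Y)$, with value $J_{\omega,N}(y_1,\dots,y_N)$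 at $\frac1N\sum_{i=1}^N\delta_{(x_i,y_i)}$ and $+\infty$ at every measure not of this form. Functionals $F_N$ on $\mathscr P(\mathcal X\times\mathcal Y)$ $\Gamma$-converge to $F$ for the narrow topology if $F(\gamma)\le\liminf_N F_N(\gamma_N)$ whenever $\gamma_N\to\gamma$ narrowly, and every $\gamma$ has a recovery sequence, that is, a sequence $\gamma_N\to\gamma$ narrowly with $\limsup_N F_N(\gamma_N)\le F(\gamma)$. **Theorem.** 1. For $\mathbb P$-almost every $\omega$, both $(\mathcal J_{\omega,N})_N$ and $(J_{\omega,N})_N$ $\Gamma$-converge to $\mathcal J$ for the narrow topology of $\mathscr P(\mathcal X\times\mathcal Y)$. 2. Let $\gamma\in\mathscr P_\mu(\mathcal X\times\mathcal Y)$ and let $(\nu^x)_{x\in\mathcal X}$ be a measurable family in $\mathscr P(\mathcal Y)$ with $\gamma=\mu\otimes\nu^x$. Then for $\mathbb P$-almost every $\omega$ the measures $\mu_N(\omega)\otimes\nu^x=\frac1N\sum_{i=1}^N\delta_{x_i}\otimes\nu^{x_i}$ form a recovery sequence of $\gamma$ for $(\mathcal J_{\omega,N})_N$. 3. Let $\gamma\in\mathscr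 P_\mu(\mathcal X\times\mathcal Y)$ and let $(Y_i)_{i\ge1}$ be $\mathcal Y$-valued random variables on $\Omega$ such that $(X_i,Y_i)_{i\ge1}$ is i.i.d. with law $\gamma$. Then for $\mathbb P$-almost every $\omega$ the measures $\frac1N\sum_{i=1}^N\delta_{(X_i(\omega),Y_i(\omega))}$ form a recovery sequence of $\gamma$ for $(J_{\omega,N})_N$. -/

import Mathlib

open MeasureTheory ProbabilityTheory Filter Topology
open scoped ENNReal

noncomputable section

namespace CournotNash

/-- `u` is a recovery sequence of `a`: it converges to `a` and
`limsup F_N (u_N) ≤ G a`. -/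
def IsRecoverySequence {E R : Type*} [TopologicalSpace E] [CompleteLattice R]
    (F : ℕ → E → R) (G : E → R) (a : E) (u : ℕ → E) : Prop :=
  Tendsto u atTop (𝓝 a) ∧ limsup (fun N => F N (u N)) atTop ≤ G a

/-- Sequential `Γ`-convergence of `F_N` to `G` (the liminf inequality along every convergent
sequence, and existence of a recovery sequence at every point). -/
def GammaConverges {E R : Type*} [TopologicalSpace E] [CompleteLattice R]
    (F : ℕ → E → R) (G : E → R) : Prop :=
  (∀ (a : E) (u : ℕ → E), Tendsto u atTop (𝓝 a) →
      G a ≤ liminf (fun N => F N (u N)) atTop) ∧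
  (∀ a : E, ∃ u : ℕ → E, IsRecoverySequence F G a u)

/-- The empirical measure `(1/N) ∑ δ_{z_i}`. -/
def empirical {E : Type*} [MeasurableSpace E] {N : ℕ} [NeZero N] (z : Fin N → E) :
    ProbabilityMeasure E :=
  ⟨(N : ℝ≥0∞)⁻¹ • ∑ i, Measure.dirac (z i), ⟨by
    simp [ENNReal.inv_mul_cancel (Nat.cast_ne_zero.2 (NeZero.ne N)) (ENNReal.natCast_ne_top N)]⟩⟩

variable {X Y : Type*} [MeasurableSpace X] [MeasurableSpace Y]

/-- The plan `(1/N) ∑ δ_{x_i} ⊗ ν_i` induced by the types `x` and the profile of mixed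
strategies `ν`. -/
def planOfProfile {N : ℕ} [NeZero N] (x : Fin N → X) (ν : Fin N → ProbabilityMeasure Y) :
    ProbabilityMeasure (X × Y) :=
  ⟨(N : ℝ≥0∞)⁻¹ • ∑ i, (Measure.dirac (x i)).prod (ν i : Measure Y), ⟨by
    simp [ENNReal.inv_mul_cancel (Nat.cast_ne_zero.2 (NeZero.ne N)) (ENNReal.natCast_ne_top N)]⟩⟩

/-- The member `ν^x` of a measurable family of probability measures. -/
def kernelAt (ν : Kernel X Y) [IsMarkovKernel ν] (x : X) : ProbabilityMeasure Y :=
  ⟨ν x, inferInstance⟩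

/-- `P_μ(X × Y)`: the plans whose first marginal is `μ`. -/
def plans (μ : ProbabilityMeasure X) : Set (ProbabilityMeasure (X × Y)) :=
  {γ | γ.map measurable_fst.aemeasurable = μ}

/-- When the types are pairwise distinct, every plan whose first marginal is their empirical
measure is induced by exactly one profile of mixed strategies. -/
theorem existsUnique_profile [MeasurableSingletonClass X] {N : ℕ} [NeZero N] {x : Fin N → X}
    (hx : Function.Injective x) {γ : ProbabilityMeasure (X × Y)} (hγ : γ ∈ plans (empirical x)) :
    ∃! ν : Fin N → ProbabilityMeasure Y, planOfProfile x ν = γ := by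
  have hN0 : (N : ℝ≥0∞) ≠ 0 := Nat.cast_ne_zero.2 (NeZero.ne N)
  have hNt : (N : ℝ≥0∞) ≠ ⊤ := ENNReal.natCast_ne_top N
  have hms : ∀ i, MeasurableSet (Prod.fst ⁻¹' {x i} : Set (X × Y)) := fun i =>
    measurable_fst (measurableSet_singleton _)
  have hmarg : (γ : Measure (X × Y)).map Prod.fst
      = (N : ℝ≥0∞)⁻¹ • ∑ i, Measure.dirac (x i) := congrArg Subtype.val hγ
  have hfib : ∀ i, (γ : Measure (X × Y)) (Prod.fst ⁻¹' {x i}) = (N : ℝ≥0∞)⁻¹ := by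
    intro i
    rw [← Measure.map_apply measurable_fst (measurableSet_singleton _), hmarg]
    rw [Measure.smul_apply, Measure.finsetSum_apply, Finset.sum_eq_single i]
    · simp
    · intro j _ hj
      simp [hx.ne hj]
    · simp
  refine ⟨fun i => ⟨(N : ℝ≥0∞) • ((γ : Measure (X × Y)).restrict (Prod.fst ⁻¹' {x i})).map
      Prod.snd, ⟨?_⟩⟩, ?_, ?_⟩
  · rw [Measure.smul_apply, Measure.map_apply measurable_snd MeasurableSet.univ]
    simp [hfib, ENNReal.mul_inv_cancel hN0 hNt]
  · apply Subtype.ext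
    change (N : ℝ≥0∞)⁻¹ • ∑ i, (Measure.dirac (x i)).prod ((N : ℝ≥0∞) •
      ((γ : Measure (X × Y)).restrict (Prod.fst ⁻¹' {x i})).map Prod.snd)
        = (γ : Measure (X × Y))
    have hnull : (γ : Measure (X × Y)) (⋃ i, Prod.fst ⁻¹' {x i})ᶜ = 0 := by
      have h : (⋃ i, Prod.fst ⁻¹' {x i} : Set (X × Y))ᶜ
          = Prod.fst ⁻¹' (Set.range x)ᶜ := by
        ext p; simp [eq_comm]
      have hr : MeasurableSet (Set.range x)ᶜ := (Set.finite_range x).measurableSet.compl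
      rw [h, ← Measure.map_apply measurable_fst hr, hmarg]
      simp [Measure.dirac_apply' _ hr]
    have hdisj : Pairwise (Function.onFun Disjoint
        fun i => (Prod.fst ⁻¹' {x i} : Set (X × Y))) := by
      intro i j hij
      exact Disjoint.preimage _ (by simpa using hx.ne hij)
    ext A hA
    rw [Measure.smul_apply, Measure.finsetSum_apply]
    have hterm : ∀ i, ((Measure.dirac (x i)).prod ((N : ℝ≥0∞) •
        ((γ : Measure (X × Y)).restrict (Prod.fst ⁻¹' {x i})).map Prod.snd)) A
          = (N : ℝ≥0∞) * (γ : Measure (X × Y)) (A ∩ Prod.fst ⁻¹' {x i}) := by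
      intro i
      rw [Measure.dirac_prod, Measure.map_apply measurable_prodMk_left hA, Measure.smul_apply,
        Measure.map_apply measurable_snd (measurable_prodMk_left hA),
        Measure.restrict_apply (measurable_snd (measurable_prodMk_left hA)), smul_eq_mul]
      congr 2
      ext ⟨a, b⟩
      simp only [Set.mem_inter_iff, Set.mem_preimage, Set.mem_singleton_iff]
      constructor
      · rintro ⟨h, rfl⟩; exact ⟨h, rfl⟩
      · rintro ⟨h, rfl⟩; exact ⟨h, rfl⟩
    simp_rw [hterm]
    rw [← Finset.mul_sum, smul_eq_mul, ← mul_assoc, ENNReal.inv_mul_cancel hN0 hNt, one_mul,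
      ← tsum_fintype (L := .unconditional _), ← measure_iUnion
        (fun i j hij => (hdisj hij).mono Set.inter_subset_right Set.inter_subset_right)
        (fun i => hA.inter (hms i)), ← Set.inter_iUnion]
    exact measure_inter_conull hnull
  · intro ν hν
    funext i
    apply Subtype.ext
    change (ν i : Measure Y) = (N : ℝ≥0∞) •
      ((γ : Measure (X × Y)).restrict (Prod.fst ⁻¹' {x i})).map Prod.snd
    ext B hB
    have hγ' : (γ : Measure (X × Y))
        = (N : ℝ≥0∞)⁻¹ • ∑ i, (Measure.dirac (x i)).prod (ν i : Measure Y) :=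
      (congrArg Subtype.val hν).symm
    have hset : (Prod.snd ⁻¹' B ∩ Prod.fst ⁻¹' {x i} : Set (X × Y)) = {x i} ×ˢ B := by
      ext p; simp [and_comm]
    rw [Measure.smul_apply, Measure.map_apply measurable_snd hB,
      Measure.restrict_apply (measurable_snd hB), hset, hγ', Measure.smul_apply,
      Measure.finsetSum_apply, Finset.sum_eq_single i]
    · rw [Measure.prod_prod, smul_eq_mul, smul_eq_mul, ← mul_assoc,
        ENNReal.mul_inv_cancel hN0 hNt]
      simp
    · intro j _ hj
      rw [Measure.prod_prod]
      simp [hx.ne hj]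
    · simp

/-- Average of `L` under `ν`. -/
def individualEnergy (L : Y → ℝ≥0∞) (ν : ProbabilityMeasure Y) : ℝ≥0∞ :=
  ∫⁻ y, L y ∂(ν : Measure Y)

/-- Average of `H` under `ν ⊗ ν'`. -/
def interactionEnergy (H : Y × Y → ℝ≥0∞) (ν ν' : ProbabilityMeasure Y) : ℝ≥0∞ :=
  ∫⁻ p, H p ∂((ν : Measure Y).prod (ν' : Measure Y))

open Classical in
/-- The potential `J` of the game with a continuum of players. -/
def limitPotential (c : X × Y → ℝ≥0∞) (L : Y → ℝ≥0∞) (H : Y × Y → ℝ≥0∞)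
    (μ : ProbabilityMeasure X) (γ : ProbabilityMeasure (X × Y)) : ℝ≥0∞ :=
  if γ ∈ plans μ then
    ∫⁻ p, c p ∂(γ : Measure (X × Y))
      + (individualEnergy L (γ.map measurable_snd.aemeasurable)
        + interactionEnergy H (γ.map measurable_snd.aemeasurable)
            (γ.map measurable_snd.aemeasurable))
  else ⊤

open Classical in
/-- The mixed-strategy potential of the `N`-player game with types `x`, as a functional of the
plan. For distinct types the infimum is over a single profile, by `existsUnique_profile`. -/
def mixedPotential (c : X × Y → ℝ≥0∞) (L : Y → ℝ≥0∞) (H : Y × Y → ℝ≥0∞)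
    {N : ℕ} [NeZero N] (x : Fin N → X) (γ : ProbabilityMeasure (X × Y)) : ℝ≥0∞ :=
  if γ ∈ plans (empirical x) then
    ⨅ (ν : Fin N → ProbabilityMeasure Y) (_ : planOfProfile x ν = γ),
      (∫⁻ p, c p ∂(γ : Measure (X × Y))
        + (N : ℝ≥0∞)⁻¹ * ∑ i, individualEnergy L (ν i)
        + ((N : ℝ≥0∞) ^ 2)⁻¹ *
            ∑ i, ∑ j ∈ Finset.univ.filter (· ≠ i), interactionEnergy H (ν i) (ν j))
  else ⊤

/-- The pure-strategy potential, as a function of the strategies `(y_1, …, y_N)`. -/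
def purePotential (c : X × Y → ℝ≥0∞) (L : Y → ℝ≥0∞) (H : Y × Y → ℝ≥0∞)
    {N : ℕ} [NeZero N] (x : Fin N → X) (y : Fin N → Y) : ℝ≥0∞ :=
  mixedPotential c L H x (empirical fun i => (x i, y i))

/-- The pure-strategy potential as a functional on plans: its value at
`(1/N) ∑ δ_{(x_i, y_i)}` is `purePotential` at `y`, and it is `⊤` at every plan which is not of
this form. (The value depends on `y` only through the plan.) -/
def purePotentialOnPlans (c : X × Y → ℝ≥0∞) (L : Y → ℝ≥0∞) (H : Y × Y → ℝ≥0∞)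
    {N : ℕ} [NeZero N] (x : Fin N → X) (γ : ProbabilityMeasure (X × Y)) : ℝ≥0∞ :=
  ⨅ (y : Fin N → Y) (_ : (empirical fun i => (x i, y i)) = γ), purePotential c L H x y

end CournotNash

end

/-!
The liminf inequality is deterministic once the empirical measures of the types converge to `μ`.
Integrals of lower semicontinuous functions are lower semicontinuous for the narrow topology, and
the only difference between the finite and the limit potentials, the missing diagonal of the
interaction, is at most `M / N` after `H` is truncated at level `M`
(`limitPotential_le_liminf_mixedPotential`). The mixed potential is below the pure one, so the
inequality for the former gives it for the latter.

The recovery sequences are samples. The individual costs converge by the strong law of large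
numbers, and the interaction is a `U`-statistic of order two with a kernel which is merely
integrable. Its almost sure limsup is bounded in `ae_limsup_pairSum_le`, by a maximal inequality
obtained from exchangeability (`mul_measure_exists_lt_pairSum_le`) together with an approximation
of the kernel from below by bounded upper semicontinuous functions.

These recovery sequences depend on the plan through their null sets. To have them for all plans at
once, it is enough to treat a countable set of plans which is dense for the narrow topology and in
energy; it exists because the graph of the limit potential is separable, and a diagonal extraction
concludes (`ae_forall_exists_isRecoverySequence`). For pure strategies the sample of strategies is
chosen after the types, by disintegrating the law of the sequence of pairs
(`ae_exists_of_ae_infinitePi`).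

All almost sure statements are proved for the coordinates of the sequence space, with the infinite
product measure, and then transferred to `Ω`.
-/

open scoped NNReal

namespace CournotNash

/-! ### Semicontinuity of integrals and the narrow topology -/

theorem lintegral_eq_iSup_lintegral_min {α : Type*} [MeasurableSpace α] {μ : Measure α}
    {f : α → ℝ≥0∞} (hf : Measurable f) :
    ∫⁻ x, f x ∂μ = ⨆ n : ℕ, ∫⁻ x, min (f x) n ∂μ := by
  rw [← lintegral_iSup (fun n => hf.min measurable_const)
    (fun n m hnm x => min_le_min_left _ (by exact_mod_cast hnm))]
  congr with x
  rw [← inf_iSup_eq (f x), ENNReal.iSup_natCast, inf_top_eq]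

section NarrowTopology

variable {E : Type*} [TopologicalSpace E] [PolishSpace E] [MeasurableSpace E] [BorelSpace E]

/-- Portmanteau theorem for extended nonnegative lower semicontinuous integrands: the layer cake
formula reduces it, after truncation, to the superlevel sets, which are open. -/
theorem lowerSemicontinuous_lintegral {f : E → ℝ≥0∞} (hf : LowerSemicontinuous f) :
    LowerSemicontinuous fun γ : ProbabilityMeasure E => ∫⁻ x, f x ∂(γ : Measure E) := by
  have hfm : Measurable f := hf.measurable
  simp_rw [lintegral_eq_iSup_lintegral_min hfm]
  refine lowerSemicontinuous_iSup fun n => ?_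
  rw [lowerSemicontinuous_iff_le_liminf]
  intro γ
  have hfin : ∀ x, min (f x) n ≠ ⊤ := fun x =>
    ne_top_of_le_ne_top (ENNReal.natCast_ne_top n) (min_le_right _ _)
  have hopen : ∀ t : ℝ, IsOpen {x | ENNReal.ofReal t < min (f x) n} := fun t =>
    (hf.inf lowerSemicontinuous_const).isOpen_preimage _
  have layer : ∀ η : ProbabilityMeasure E, ∫⁻ x, min (f x) n ∂(η : Measure E)
      = ∫⁻ t in Set.Ioi (0 : ℝ), (η : Measure E) {x | ENNReal.ofReal t < min (f x) n} := by
    intro η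
    calc ∫⁻ x, min (f x) n ∂(η : Measure E)
        = ∫⁻ x, ENNReal.ofReal (min (f x) n).toReal ∂(η : Measure E) := by
          simp_rw [ENNReal.ofReal_toReal (hfin _)]
      _ = ∫⁻ t in Set.Ioi (0 : ℝ), (η : Measure E) {x | t < (min (f x) n).toReal} :=
          lintegral_eq_lintegral_meas_lt _ (Eventually.of_forall fun x => ENNReal.toReal_nonneg)
            (hfm.min measurable_const).ennreal_toReal.aemeasurable
      _ = _ := by
          refine setLIntegral_congr_fun measurableSet_Ioi fun t ht => ?_
          simp_rw [ENNReal.ofReal_lt_iff_lt_toReal (le_of_lt ht) (hfin _)]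
  simp_rw [layer]
  refine (lintegral_mono fun t => ?_).trans (lintegral_liminf_le fun η => ?_)
  · exact ProbabilityMeasure.le_liminf_measure_open_of_tendsto tendsto_id (hopen t)
  · exact Antitone.measurable fun s t hst =>
      measure_mono fun x hx => (ENNReal.ofReal_le_ofReal hst).trans_lt hx

theorem limsup_lintegral_le_of_upperSemicontinuous {ι : Type*} {l : Filter ι}
    {γs : ι → ProbabilityMeasure E} {γ : ProbabilityMeasure E} (hγ : Tendsto γs l (𝓝 γ))
    {g : E → ℝ≥0} (hg : UpperSemicontinuous g) {M : ℝ≥0} (hM : ∀ x, g x ≤ M) :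
    limsup (fun i => ∫⁻ x, g x ∂(γs i : Measure E)) l ≤ ∫⁻ x, g x ∂(γ : Measure E) := by
  have hgm : Measurable g := hg.measurable
  have hlsc : LowerSemicontinuous fun x => ((M - g x : ℝ≥0) : ℝ≥0∞) :=
    Continuous.comp_upperSemicontinuous_antitone (g := fun t : ℝ≥0 => ((M - t : ℝ≥0) : ℝ≥0∞))
      (by fun_prop) hg (fun s t hst => ENNReal.coe_le_coe.2 (tsub_le_tsub_left hst M))
  have hcompl : ∀ η : ProbabilityMeasure E, ∫⁻ x, g x ∂(η : Measure E)
      = M - ∫⁻ x, ((M - g x : ℝ≥0) : ℝ≥0∞) ∂(η : Measure E) := by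
    intro η
    refine ENNReal.eq_sub_of_add_eq (ne_top_of_le_ne_top (ENNReal.coe_ne_top (r := M)) ?_) ?_
    · calc ∫⁻ x, ((M - g x : ℝ≥0) : ℝ≥0∞) ∂(η : Measure E)
          ≤ ∫⁻ _, M ∂(η : Measure E) := lintegral_mono fun x => by
            exact ENNReal.coe_le_coe.2 tsub_le_self
        _ = M := by simp
    · rw [← lintegral_add_left hgm.coe_nnreal_ennreal]
      simp_rw [← ENNReal.coe_add, add_tsub_cancel_of_le (hM _)]
      simp
  simp_rw [hcompl]
  rw [ENNReal.limsup_const_sub _ _ ENNReal.coe_ne_top]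
  gcongr
  exact ((lowerSemicontinuous_lintegral hlsc).le_liminf γ).trans (liminf_le_liminf_of_le hγ)

/-- A countable convergence-determining class: the finite intersections of a countable basis. -/
theorem exists_countable_isPiSystem_isOpen (E : Type*) [TopologicalSpace E]
    [SecondCountableTopology E] :
    ∃ S : Set (Set E), S.Countable ∧ IsPiSystem S ∧ (∀ s ∈ S, IsOpen s) ∧
      ∀ u, IsOpen u → ∀ x ∈ u, ∃ s ∈ S, s ∈ 𝓝 x ∧ s ⊆ u := by
  have hB := TopologicalSpace.isBasis_countableBasis E
  refine ⟨Set.sInter '' {F | F.Finite ∧ F ⊆ TopologicalSpace.countableBasis E},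
    (Set.countable_ofPred_finite_subset (TopologicalSpace.countable_countableBasis E)).image _,
    ?_, ?_, ?_⟩
  · rintro _ ⟨F, hF, rfl⟩ _ ⟨G, hG, rfl⟩ -
    exact ⟨F ∪ G, ⟨hF.1.union hG.1, Set.union_subset hF.2 hG.2⟩, Set.sInter_union F G⟩
  · rintro _ ⟨F, hF, rfl⟩
    exact hF.1.isOpen_sInter fun s hs => hB.isOpen (hF.2 hs)
  · intro u hu x hx
    obtain ⟨s, hs, hxs, hsu⟩ := hB.exists_subset_of_mem_open hx hu
    exact ⟨s, ⟨{s}, by simpa using hs, by simp⟩, (hB.isOpen hs).mem_nhds hxs, hsu⟩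

/-- Evaluation on a countable convergence-determining class `S` embeds the probability measures
into the separable space `S → ℝ≥0`, and convergence of the values implies narrow convergence. -/
instance separableSpace_probabilityMeasure :
    TopologicalSpace.SeparableSpace (ProbabilityMeasure E) := by
  obtain ⟨S, hSc, hSpi, hSo, hS⟩ := exists_countable_isPiSystem_isOpen E
  have : Countable S := hSc.to_subtype
  let Φ : ProbabilityMeasure E → S → ℝ≥0 := fun γ s => γ s
  have : TopologicalSpace.SeparableSpace (Set.range Φ) := inferInstance
  obtain ⟨D, hDc, hD⟩ := TopologicalSpace.exists_countable_dense (Set.range Φ)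
  choose g hg using fun q : Set.range Φ => q.2
  refine ⟨g '' D, hDc.image g, fun γ => ?_⟩
  obtain ⟨q, hqD, hq⟩ := mem_closure_iff_seq_limit.1 (hD ⟨Φ γ, γ, rfl⟩)
  refine mem_closure_of_tendsto (b := atTop) (f := fun k => g (q k)) ?_
    (Eventually.of_forall fun k => Set.mem_image_of_mem g (hqD k))
  refine hSpi.tendsto_probabilityMeasure_of_tendsto_of_mem (fun s hs => (hSo s hs).measurableSet)
    hS fun s hs => ?_
  have hlim := (tendsto_pi_nhds.1 ((continuous_subtype_val.tendsto _).comp hq)) ⟨s, hs⟩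
  refine hlim.congr fun k => ?_
  exact congrFun (hg (q k)).symm ⟨s, hs⟩

instance secondCountableTopology_probabilityMeasure :
    SecondCountableTopology (ProbabilityMeasure E) := by
  let := TopologicalSpace.metrizableSpaceMetric (ProbabilityMeasure E)
  exact UniformSpace.secondCountable_of_separable _

/-- The exceptional null set in the hypothesis may depend on `s`; countably many `s` suffice to
test narrow convergence. -/
theorem ae_tendsto_of_forall_ae_tendsto_measure {Ω : Type*} [MeasurableSpace Ω] {P : Measure Ω}
    {γs : Ω → ℕ → ProbabilityMeasure E} {γ : ProbabilityMeasure E}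
    (h : ∀ s, MeasurableSet s → ∀ᵐ ω ∂P,
      Tendsto (fun N => (γs ω N : Measure E) s) atTop (𝓝 ((γ : Measure E) s))) :
    ∀ᵐ ω ∂P, Tendsto (γs ω) atTop (𝓝 γ) := by
  obtain ⟨S, hSc, hSpi, hSo, hS⟩ := exists_countable_isPiSystem_isOpen E
  have hae : ∀ᵐ ω ∂P, ∀ s ∈ S,
      Tendsto (fun N => (γs ω N : Measure E) s) atTop (𝓝 ((γ : Measure E) s)) :=
    (ae_ball_iff hSc).2 fun s hs => h s (hSo s hs).measurableSet
  filter_upwards [hae] with ω hω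
  refine hSpi.tendsto_probabilityMeasure_of_tendsto_of_mem (fun s hs => (hSo s hs).measurableSet)
    hS fun s hs => ?_
  exact (ENNReal.tendsto_toNNReal (measure_ne_top _ _)).comp (hω s hs)

end NarrowTopology

/-! ### Recovery sequences and countable dense subsets of the graph -/

section GammaConvergence

/-- Diagonal extraction: at rank `N` the sequence satisfies the strongest of the first `N`
requirements that can be met. -/
theorem exists_seq_of_forall_eventually_exists {E : Type*} [Nonempty E] {p : ℕ → ℕ → E → Prop}
    (hp : ∀ {k l N v}, k ≤ l → p l N v → p k N v) (h : ∀ k, ∀ᶠ N in atTop, ∃ v, p k N v) :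
    ∃ u : ℕ → E, ∀ k, ∀ᶠ N in atTop, p k N (u N) := by
  classical
  let K : ℕ → ℕ := fun N => Nat.findGreatest (fun k => ∃ v, p k N v) N
  refine ⟨fun N => if hN : ∃ v, p (K N) N v then hN.choose else Classical.arbitrary E,
    fun k => ?_⟩
  filter_upwards [h k, eventually_ge_atTop k] with N hN hkN
  have hK : ∃ v, p (K N) N v := Nat.findGreatest_spec (P := fun k => ∃ v, p k N v) hkN hN
  rw [dif_pos hK]
  exact hp (Nat.le_findGreatest hkN hN) hK.choose_spec

/-- Almost sure existence of recovery sequences can be checked one point at a time. The graph of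
`G` over `{G < ⊤}` is separable, so it has a countable dense subset; recovery sequences of its
points exist simultaneously outside one null set, and a diagonal extraction gives all the others.
Where `G = ⊤` the constant sequence works. -/
theorem ae_forall_exists_isRecoverySequence {Ω E : Type*} [MeasurableSpace Ω] {P : Measure Ω}
    [TopologicalSpace E] [SecondCountableTopology E] {F : Ω → ℕ → E → ℝ≥0∞} {G : E → ℝ≥0∞}
    (h : ∀ a, G a < ⊤ → ∀ᵐ ω ∂P, ∃ u, IsRecoverySequence (F ω) G a u) :
    ∀ᵐ ω ∂P, ∀ a, ∃ u, IsRecoverySequence (F ω) G a u := by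
  obtain ⟨D, hDc, hD⟩ : ∃ D : Set {q : E × ℝ≥0∞ // q.2 = G q.1 ∧ G q.1 < ⊤},
      D.Countable ∧ Dense D := by
    have : SecondCountableTopology {q : E × ℝ≥0∞ // q.2 = G q.1 ∧ G q.1 < ⊤} :=
      TopologicalSpace.Subtype.secondCountableTopology _
    exact TopologicalSpace.exists_countable_dense _
  have hae : ∀ᵐ ω ∂P, ∀ q ∈ D, ∃ u, IsRecoverySequence (F ω) G q.1.1 u :=
    (ae_ball_iff hDc).2 fun q _ => h q.1.1 q.2.2
  filter_upwards [hae] with ω hω a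
  by_cases ha : G a < ⊤
  swap
  · exact ⟨fun _ => a, tendsto_const_nhds, le_of_le_of_eq le_top (not_lt_top_iff.1 ha).symm⟩
  obtain ⟨U, hU⟩ := (𝓝 a).exists_antitone_basis
  have : Nonempty E := ⟨a⟩
  obtain ⟨u, hu⟩ := exists_seq_of_forall_eventually_exists
    (p := fun k N v => v ∈ U k ∧ F ω N v < G a + ((k : ℝ≥0∞) + 1)⁻¹)
    (fun {k l N v} hkl hv => ⟨hU.antitone hkl hv.1, hv.2.trans_le (by gcongr)⟩) (by
      intro k
      have hε : G a < G a + ((k : ℝ≥0∞) + 1)⁻¹ :=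
        ENNReal.lt_add_right ha.ne (ENNReal.inv_ne_zero.2 (by finiteness))
      have hnhds : interior (U k) ×ˢ Set.Iio (G a + ((k : ℝ≥0∞) + 1)⁻¹) ∈ 𝓝 (a, G a) :=
        prod_mem_nhds (interior_mem_nhds.2 (hU.mem k)) (Iio_mem_nhds hε)
      let q₀ : {q : E × ℝ≥0∞ // q.2 = G q.1 ∧ G q.1 < ⊤} := ⟨(a, G a), rfl, ha⟩
      obtain ⟨q, hq, hqD⟩ := mem_closure_iff_nhds.1 (hD q₀) _
        (continuous_subtype_val.continuousAt.preimage_mem_nhds (x := q₀) hnhds)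
      obtain ⟨u, hu, hu'⟩ := hω q hqD
      have h1 : ∀ᶠ N in atTop, u N ∈ interior (U k) :=
        hu (isOpen_interior.mem_nhds hq.1)
      have h2 : ∀ᶠ N in atTop, F ω N (u N) < G a + ((k : ℝ≥0∞) + 1)⁻¹ :=
        eventually_lt_of_limsup_lt (hu'.trans_lt (q.2.1 ▸ hq.2))
      filter_upwards [h1, h2] with N hN1 hN2
      exact ⟨u N, interior_subset hN1, hN2⟩)
  refine ⟨u, hU.tendsto_right_iff.2 fun k _ => (hu k).mono fun N hN => hN.1, ?_⟩
  have hlim : Tendsto (fun k : ℕ => G a + ((k : ℝ≥0∞) + 1)⁻¹) atTop (𝓝 (G a)) := by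
    have := (tendsto_add_atTop_iff_nat 1).2 ENNReal.tendsto_inv_nat_nhds_zero
    simpa using (tendsto_const_nhds (x := G a)).add this
  exact ge_of_tendsto' hlim fun k =>
    limsup_le_of_le (by isBoundedDefault) ((hu k).mono fun N hN => hN.2.le)

end GammaConvergence

/-! ### Integrals against empirical measures -/

section EmpiricalIntegrals

variable {X Y : Type*} [MeasurableSpace X] [MeasurableSpace Y]

theorem lintegral_empirical {N : ℕ} [NeZero N] (z : Fin N → X) {f : X → ℝ≥0∞}
    (hf : Measurable f) :
    ∫⁻ x, f x ∂(empirical z : Measure X) = (N : ℝ≥0∞)⁻¹ * ∑ i, f (z i) := by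
  change ∫⁻ x, f x ∂((N : ℝ≥0∞)⁻¹ • ∑ i, Measure.dirac (z i)) = _
  simp [lintegral_finsetSum_measure, lintegral_dirac' _ hf]

theorem lintegral_planOfProfile {N : ℕ} [NeZero N] (x : Fin N → X)
    (ν : Fin N → ProbabilityMeasure Y) {f : X × Y → ℝ≥0∞} (hf : Measurable f) :
    ∫⁻ p, f p ∂(planOfProfile x ν : Measure (X × Y))
      = (N : ℝ≥0∞)⁻¹ * ∑ i, ∫⁻ y, f (x i, y) ∂(ν i : Measure Y) := by
  change ∫⁻ p, f p ∂((N : ℝ≥0∞)⁻¹ • ∑ i, (Measure.dirac (x i)).prod (ν i : Measure Y)) = _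
  simp [lintegral_finsetSum_measure, lintegral_prod _ hf.aemeasurable,
    lintegral_dirac' _ hf.lintegral_prod_right']

end EmpiricalIntegrals

/-! ### Laws of large numbers for averages and for sums over pairs -/

section IID

variable {E : Type*} [MeasurableSpace E] (m : Measure E) [IsProbabilityMeasure m]

/-- The strong law of large numbers for a nonnegative integrable function of the coordinates of an
i.i.d. sequence with law `m`, realized on the sequence space. -/
theorem ae_tendsto_average {f : E → ℝ≥0∞} (hf : Measurable f) (hfi : ∫⁻ e, f e ∂m ≠ ⊤) :
    ∀ᵐ z ∂Measure.infinitePi (fun _ : ℕ => m),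
      Tendsto (fun N : ℕ => ((N + 1 : ℕ) : ℝ≥0∞)⁻¹ * ∑ i : Fin (N + 1), f (z i)) atTop
        (𝓝 (∫⁻ e, f e ∂m)) := by
  have hpres : ∀ i : ℕ, MeasurePreserving (fun z : ℕ → E => z i)
      (Measure.infinitePi fun _ : ℕ => m) m := fun i =>
    measurePreserving_eval_infinitePi (fun _ : ℕ => m) i
  have hint : Integrable (fun e => (f e).toReal) m :=
    integrable_toReal_of_lintegral_ne_top hf.aemeasurable hfi
  have hfin : ∀ᵐ z ∂Measure.infinitePi (fun _ : ℕ => m), ∀ i : ℕ, f (z i) < ⊤ :=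
    ae_all_iff.2 fun i => (hpres i).quasiMeasurePreserving.ae (ae_lt_top hf hfi)
  have hslln := strong_law_ae_real (μ := Measure.infinitePi fun _ : ℕ => m)
    (fun i z => (f (z i)).toReal) ((hpres 0).integrable_comp_of_integrable hint)
    (fun i j hij => (iIndepFun_infinitePi (P := fun _ : ℕ => m) (X := fun _ e => (f e).toReal)
      fun _ => hf.ennreal_toReal).indepFun hij)
    (fun i => ⟨(hf.ennreal_toReal.comp (measurable_pi_apply i)).aemeasurable,
      (hf.ennreal_toReal.comp (measurable_pi_apply 0)).aemeasurable, by
        change Measure.map ((fun e => (f e).toReal) ∘ fun z : ℕ → E => z i) _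
          = Measure.map ((fun e => (f e).toReal) ∘ fun z : ℕ → E => z 0) _
        rw [← Measure.map_map hf.ennreal_toReal (measurable_pi_apply i),
          ← Measure.map_map hf.ennreal_toReal (measurable_pi_apply 0),
          (hpres i).map_eq, (hpres 0).map_eq]⟩)
  have hmean : ∫ z, (f (z 0)).toReal ∂Measure.infinitePi (fun _ : ℕ => m)
      = (∫⁻ e, f e ∂m).toReal := by
    rw [← integral_toReal hf.aemeasurable (ae_lt_top hf hfi), ← (hpres 0).map_eq,
      integral_map (measurable_pi_apply 0).aemeasurable
        hf.ennreal_toReal.aestronglyMeasurable]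
    simp_rw [(hpres 0).map_eq]
  filter_upwards [hslln, hfin] with z hz hzfin
  rw [hmean] at hz
  have h := ENNReal.tendsto_ofReal ((tendsto_add_atTop_iff_nat 1).2 hz)
  rw [ENNReal.ofReal_toReal hfi] at h
  refine h.congr fun N => ?_
  rw [ENNReal.ofReal_div_of_pos (by positivity), ENNReal.ofReal_natCast,
    ENNReal.ofReal_sum_of_nonneg fun i _ => ENNReal.toReal_nonneg, ENNReal.div_eq_inv_mul,
    Finset.sum_range]
  simp_rw [ENNReal.ofReal_toReal (hzfin _).ne]

theorem measurePreserving_comp_perm (σ : Equiv.Perm ℕ) :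
    MeasurePreserving (fun z : ℕ → E => z ∘ σ) (Measure.infinitePi fun _ : ℕ => m)
      (Measure.infinitePi fun _ : ℕ => m) := by
  have hmeas : Measurable fun z : ℕ → E => z ∘ σ :=
    measurable_pi_iff.2 fun i => measurable_pi_apply (σ i)
  refine ⟨hmeas, Measure.eq_infinitePi _ fun s t ht => ?_⟩
  rw [Measure.map_apply hmeas (MeasurableSet.pi s.countable_toSet fun i _ => ht i)]
  have hset : (fun z : ℕ → E => z ∘ σ) ⁻¹' (s : Set ℕ).pi t
      = ((s.map σ.toEmbedding : Finset ℕ) : Set ℕ).pi fun i => t (σ.symm i) := by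
    ext z
    refine ⟨fun hz i hi => ?_, fun hz i hi => ?_⟩
    · obtain ⟨j, hj, rfl⟩ := Finset.mem_map.1 hi
      simpa using hz j hj
    · simpa using hz (σ i) (Finset.mem_map_of_mem _ hi)
  rw [hset, Measure.infinitePi_pi _ fun i _ => ht _, Finset.prod_map]
  simp

/-- The sum of `h (z_i, z_j)` over the ordered pairs of distinct indices `i, j < N`. -/
noncomputable def pairSum (h : E × E → ℝ≥0∞) (N : ℕ) (z : ℕ → E) : ℝ≥0∞ :=
  ∑ p ∈ (Finset.range N).offDiag, h (z p.1, z p.2)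

variable {h : E × E → ℝ≥0∞}

theorem measurable_pairSum (hh : Measurable h) (N : ℕ) : Measurable (pairSum h N) :=
  Finset.measurable_fun_sum _ fun p _ =>
    hh.comp ((measurable_pi_apply p.1).prodMk (measurable_pi_apply p.2))

omit [MeasurableSpace E] in
theorem pairSum_comp_perm {N : ℕ} {σ : Equiv.Perm ℕ} (hσ : ∀ i, σ i < N ↔ i < N) (z : ℕ → E) :
    pairSum h N (z ∘ σ) = pairSum h N z := by
  refine Finset.sum_equiv (σ.prodCongr σ) (fun p => ?_) fun p _ => rfl
  simp [hσ]

/-- Any two distinct indices below `k` are the images of `0` and `1` under a permutation that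
preserves every initial segment of length at least `k`. -/
theorem exists_perm_apply_zero_one {i j k : ℕ} (hi : i < k) (hj : j < k) (hij : i ≠ j) :
    ∃ σ : Equiv.Perm ℕ, σ 0 = i ∧ σ 1 = j ∧ ∀ N, k ≤ N → ∀ a, σ a < N ↔ a < N := by
  have hswap : ∀ {a b N : ℕ}, a < N → b < N → ∀ c, Equiv.swap a b c < N ↔ c < N := by
    intro a b N ha hb c
    rw [Equiv.swap_apply_def]
    split_ifs <;> omega
  have h1 : 1 < k := by omega
  have hj' : Equiv.swap 0 i j < k := (hswap (by omega) hi j).2 hj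
  have hj0 : Equiv.swap 0 i j ≠ 0 := by
    rw [Equiv.swap_apply_def]
    split_ifs <;> omega
  refine ⟨(Equiv.swap 1 (Equiv.swap 0 i j)).trans (Equiv.swap 0 i), ?_, ?_, fun N hN a => ?_⟩
  · simp [Equiv.swap_apply_of_ne_of_ne zero_ne_one hj0.symm]
  · simp
  · rw [Equiv.trans_apply, hswap (by omega) (by omega), hswap (by omega) (by omega)]

theorem lintegral_apply_zero_one (hh : Measurable h) :
    ∫⁻ z : ℕ → E, h (z 0, z 1) ∂Measure.infinitePi (fun _ : ℕ => m) = ∫⁻ p, h p ∂m.prod m := by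
  have hind : IndepFun (fun z : ℕ → E => z 0) (fun z => z 1) (Measure.infinitePi fun _ : ℕ => m) :=
    (iIndepFun_infinitePi (P := fun _ : ℕ => m) (X := fun _ e => e)
      fun _ => measurable_id).indepFun zero_ne_one
  have hmap := (indepFun_iff_map_prod_eq_prod_map_map (measurable_pi_apply 0).aemeasurable
    (measurable_pi_apply 1).aemeasurable).1 hind
  rw [Measure.infinitePi_map_eval, Measure.infinitePi_map_eval] at hmap
  rw [← hmap, lintegral_map hh ((measurable_pi_apply 0).prodMk (measurable_pi_apply 1))]

/-- A weak-type maximal inequality for the averages of `h` over the ordered pairs of distinct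
indices `< N`. It is Doob's inequality for these averages, a martingale in reversed time, proved
directly: if `k` is the last rank `≤ M` at which the average exceeds `r`, then the event that this
happens is invariant under the permutations of the first `k` coordinates, so on it all the terms
`h (z_i, z_j)` have the same integral as `h (z_0, z_1)`. -/
theorem mul_measure_exists_lt_pairSum_le (hh : Measurable h) {r : ℝ≥0∞} :
    r * Measure.infinitePi (fun _ : ℕ => m)
        {z | ∃ N, r * ((Finset.range N).offDiag.card : ℝ≥0∞) < pairSum h N z}
      ≤ ∫⁻ p, h p ∂m.prod m := by
  set Q := Measure.infinitePi fun _ : ℕ => m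
  let n : ℕ → ℝ≥0∞ := fun N => ((Finset.range N).offDiag.card : ℝ≥0∞)
  have hS := measurable_pairSum hh
  have h01 : Measurable fun z : ℕ → E => h (z 0, z 1) :=
    hh.comp ((measurable_pi_apply 0).prodMk (measurable_pi_apply 1))
  -- `A M k` is the event that `k` is the last rank up to `M` at which the average exceeds `r`
  let A : ℕ → ℕ → Set (ℕ → E) := fun M k =>
    {z | r * n k < pairSum h k z} ∩ {z | ∀ j, k < j → j ≤ M → pairSum h j z ≤ r * n j}
  have hAm : ∀ M k, MeasurableSet (A M k) := by
    intro M k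
    refine (measurableSet_lt measurable_const (hS k)).inter ?_
    simp_rw [Set.ofPred_forall]
    exact .iInter fun j => .iInter fun _ => .iInter fun _ => measurableSet_le (hS j) measurable_const
  have hAk : ∀ M k, r * Q (A M k) ≤ ∫⁻ z in A M k, h (z 0, z 1) ∂Q := by
    intro M k
    -- there is no pair of distinct indices below `k` when `k < 2`
    rcases Nat.lt_or_ge k 2 with hk | hk
    · have : A M k = ∅ := by
        refine Set.eq_empty_of_forall_notMem fun z hz => ?_
        have h0 : pairSum h k z = 0 := by
          interval_cases k <;> simp [pairSum]
        exact not_lt_zero (hz.1.trans_eq h0)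
      simp [this]
    have hexch : ∀ p ∈ (Finset.range k).offDiag,
        ∫⁻ z in A M k, h (z p.1, z p.2) ∂Q = ∫⁻ z in A M k, h (z 0, z 1) ∂Q := by
      rintro ⟨i, j⟩ hp
      simp only [Finset.mem_offDiag, Finset.mem_range] at hp
      obtain ⟨σ, h0, h1, hσ⟩ := exists_perm_apply_zero_one hp.1 hp.2.1 hp.2.2
      have hinv : (fun z : ℕ → E => z ∘ σ) ⁻¹' A M k = A M k := by
        ext z
        simp only [A, Set.mem_preimage, Set.mem_inter_iff, Set.mem_ofPred_eq]
        rw [pairSum_comp_perm (hσ k le_rfl)]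
        refine and_congr_right fun _ => forall_congr' fun j => imp_congr_right fun hj => ?_
        rw [pairSum_comp_perm (hσ j hj.le)]
      have := (measurePreserving_comp_perm m σ).setLIntegral_comp_preimage (hAm M k) h01
      rw [hinv] at this
      simpa [h0, h1] using this
    have hn0 : n k ≠ 0 := by
      simp only [n, ne_eq, Nat.cast_eq_zero, Finset.card_eq_zero]
      exact Finset.Nonempty.ne_empty ⟨(0, 1), by simp; omega⟩
    have hnt : n k ≠ ⊤ := ENNReal.natCast_ne_top _
    rw [← ENNReal.mul_le_mul_iff_right hn0 hnt]
    calc n k * (r * Q (A M k)) = ∫⁻ _ in A M k, r * n k ∂Q := by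
          rw [setLIntegral_const]; ring
      _ ≤ ∫⁻ z in A M k, pairSum h k z ∂Q := setLIntegral_mono (hS k) fun z hz => hz.1.le
      _ = ∑ p ∈ (Finset.range k).offDiag, ∫⁻ z in A M k, h (z p.1, z p.2) ∂Q :=
          lintegral_finsetSum _ fun p _ =>
            hh.comp ((measurable_pi_apply p.1).prodMk (measurable_pi_apply p.2))
      _ = n k * ∫⁻ z in A M k, h (z 0, z 1) ∂Q := by
          rw [Finset.sum_congr rfl hexch, Finset.sum_const, nsmul_eq_mul]
  have hlt : ∀ {M k l : ℕ}, l ≤ M → k < l → Disjoint (A M k) (A M l) := fun hl hkl =>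
    Set.disjoint_left.2 fun z hzk hzl => (hzl.1.trans_le (hzk.2 _ hkl hl)).false
  have hdisj : ∀ M, (Finset.range (M + 1) : Set ℕ).PairwiseDisjoint (A M) := by
    intro M k hk l hl hkl
    rcases lt_or_gt_of_ne hkl with hkl | hkl
    · exact hlt (Finset.mem_range_succ_iff.1 hl) hkl
    · exact (hlt (Finset.mem_range_succ_iff.1 hk) hkl).symm
  have hM : ∀ M, r * Q {z | ∃ N ≤ M, r * n N < pairSum h N z} ≤ ∫⁻ p, h p ∂m.prod m := by
    intro M
    have hcover : {z | ∃ N ≤ M, r * n N < pairSum h N z}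
        ⊆ ⋃ k ∈ Finset.range (M + 1), A M k := by
      classical
      rintro z ⟨N, hNM, hN⟩
      have hk := Nat.findGreatest_spec (P := fun N => r * n N < pairSum h N z) hNM hN
      simp only [Set.mem_iUnion]
      refine ⟨Nat.findGreatest (fun N => r * n N < pairSum h N z) M,
        Finset.mem_range_succ_iff.2 (Nat.findGreatest_le M), hk, fun j hj hjM => ?_⟩
      exact not_lt.1 (Nat.findGreatest_is_greatest hj hjM)
    calc r * Q {z | ∃ N ≤ M, r * n N < pairSum h N z}
        ≤ r * ∑ k ∈ Finset.range (M + 1), Q (A M k) := by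
          gcongr
          exact (measure_mono hcover).trans (measure_biUnion_finset_le _ _)
      _ ≤ ∑ k ∈ Finset.range (M + 1), ∫⁻ z in A M k, h (z 0, z 1) ∂Q := by
          rw [Finset.mul_sum]
          exact Finset.sum_le_sum fun k _ => hAk M k
      _ = ∫⁻ z in ⋃ k ∈ Finset.range (M + 1), A M k, h (z 0, z 1) ∂Q :=
          (lintegral_biUnion_finset (hdisj M) (fun k _ => hAm M k) _).symm
      _ ≤ ∫⁻ z, h (z 0, z 1) ∂Q := setLIntegral_le_lintegral _ _
      _ = ∫⁻ p, h p ∂m.prod m := lintegral_apply_zero_one m hh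
  have hunion : {z | ∃ N, r * n N < pairSum h N z}
      = ⋃ M, {z | ∃ N ≤ M, r * n N < pairSum h N z} := by
    ext z
    simp only [Set.mem_ofPred_eq, Set.mem_iUnion]
    exact ⟨fun ⟨N, hN⟩ => ⟨N, N, le_rfl, hN⟩, fun ⟨_, N, _, hN⟩ => ⟨N, hN⟩⟩
  change r * Q {z | ∃ N, r * n N < pairSum h N z} ≤ _
  have hmono : Monotone fun M => {z | ∃ N ≤ M, r * n N < pairSum h N z} :=
    fun M M' hMM' z ⟨N, hN, hN'⟩ => ⟨N, hN.trans hMM', hN'⟩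
  rw [hunion, hmono.measure_iUnion, ENNReal.mul_iSup]
  exact iSup_le hM

end IID

section

variable {E : Type*} [TopologicalSpace E] [PolishSpace E] [MeasurableSpace E] [BorelSpace E]

theorem ae_tendsto_empirical (m : ProbabilityMeasure E) :
    ∀ᵐ z ∂Measure.infinitePi (fun _ : ℕ => (m : Measure E)),
      Tendsto (fun N => empirical fun i : Fin (N + 1) => z i) atTop (𝓝 m) := by
  refine ae_tendsto_of_forall_ae_tendsto_measure fun s hs => ?_
  have hf : Measurable (s.indicator (1 : E → ℝ≥0∞)) := measurable_one.indicator hs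
  have hfi : ∫⁻ e, s.indicator 1 e ∂(m : Measure E) ≠ ⊤ := by
    rw [lintegral_indicator_one hs]
    exact measure_ne_top _ _
  filter_upwards [ae_tendsto_average (m : Measure E) hf hfi] with z hz
  simpa only [← lintegral_empirical _ hf, lintegral_indicator_one hs] using hz

omit [TopologicalSpace E] [PolishSpace E] [BorelSpace E] in
theorem mul_pairSum_le_lintegral_empirical_prod (z : ℕ → E) (N : ℕ) {f : E × E → ℝ≥0∞}
    (hf : Measurable f) :
    (((N + 1 : ℕ) : ℝ≥0∞) ^ 2)⁻¹ * pairSum f (N + 1) z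
      ≤ ∫⁻ p, f p ∂((empirical fun i : Fin (N + 1) => z i).prod
          (empirical fun i : Fin (N + 1) => z i) : ProbabilityMeasure (E × E)) := by
  rw [ProbabilityMeasure.toMeasure_prod, lintegral_prod _ hf.aemeasurable,
    lintegral_empirical _ hf.lintegral_prod_right']
  have hinner : ∀ a : E, ∫⁻ b, f (a, b) ∂(empirical fun i : Fin (N + 1) => z i : Measure E)
      = ((N + 1 : ℕ) : ℝ≥0∞)⁻¹ * ∑ j : Fin (N + 1), f (a, z j) := fun a =>
    lintegral_empirical _ (hf.comp measurable_prodMk_left)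
  simp_rw [hinner]
  rw [← Finset.mul_sum, ← mul_assoc, pow_two,
    ENNReal.mul_inv (Or.inl (by simp)) (Or.inl (by simp))]
  gcongr
  have hsum : ∑ i : Fin (N + 1), ∑ j : Fin (N + 1), f (z i, z j)
      = ∑ p ∈ Finset.range (N + 1) ×ˢ Finset.range (N + 1), f (z p.1, z p.2) := by
    simp only [Finset.sum_product, Finset.sum_range]
  rw [hsum]
  exact Finset.sum_le_sum_of_subset fun p hp => by
    simp only [Finset.mem_offDiag] at hp
    exact Finset.mem_product.2 ⟨hp.1, hp.2.1⟩

/-- The upper half of the strong law of large numbers for `U`-statistics of order two, for a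
nonnegative measurable kernel. The kernel is the sum of a bounded upper semicontinuous function,
controlled by the narrow convergence of the empirical measures, and of a remainder with small
integral, controlled by the maximal inequality. -/
theorem ae_limsup_pairSum_le (m : ProbabilityMeasure E) {h : E × E → ℝ≥0∞} (hh : Measurable h) :
    ∀ᵐ z ∂Measure.infinitePi (fun _ : ℕ => (m : Measure E)),
      limsup (fun N : ℕ => (((N + 1 : ℕ) : ℝ≥0∞) ^ 2)⁻¹ * pairSum h (N + 1) z) atTop
        ≤ ∫⁻ p, h p ∂(m : Measure E).prod (m : Measure E) := by
  set Q := Measure.infinitePi fun _ : ℕ => (m : Measure E)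
  set I := ∫⁻ p, h p ∂(m : Measure E).prod (m : Measure E) with hI
  by_cases hfin : I = ⊤
  · simp [hfin]
  let V : (E × E → ℝ≥0∞) → ℕ → (ℕ → E) → ℝ≥0∞ := fun f N z =>
    (((N + 1 : ℕ) : ℝ≥0∞) ^ 2)⁻¹ * pairSum f (N + 1) z
  have main : ∀ r : ℝ≥0∞, r ≠ 0 → r ≠ ⊤ →
      ∀ᵐ z ∂Q, limsup (fun N => V h N z) atTop ≤ I + r := by
    intro r hr0 hrt
    have hbound : r * Q {z | ¬ limsup (fun N => V h N z) atTop ≤ I + r} ≤ 0 := by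
      refine le_of_forall_gt_imp_ge_of_dense fun ε hε => ?_
      obtain ⟨M, g, hgM, hgusc, hgh, hgε⟩ : ∃ (M : ℝ≥0) (g : E × E → ℝ≥0), (∀ p, g p ≤ M) ∧
          UpperSemicontinuous g ∧ (∀ p, (g p : ℝ≥0∞) ≤ h p) ∧
          I ≤ ∫⁻ p, g p ∂(m : Measure E).prod (m : Measure E) + ε := by
        -- truncation first makes the kernel finite, and the minorant of Vitali-Carathéodory bounded
        have hn : ∃ n : ℕ, I ≤ ∫⁻ p, min (h p) n ∂(m : Measure E).prod (m : Measure E) + ε / 2 := by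
          rcases eq_or_ne I 0 with h0 | h0
          · exact ⟨0, by simp [h0]⟩
          have hlt : I - ε / 2 < I := ENNReal.sub_lt_self hfin h0 (by simpa using hε.ne')
          nth_rw 2 [hI] at hlt
          rw [lintegral_eq_iSup_lintegral_min hh, lt_iSup_iff] at hlt
          exact hlt.imp fun n hn => tsub_le_iff_right.1 hn.le
        obtain ⟨n, hn⟩ := hn
        have hcoe : ∀ p, ((min (h p) n).toNNReal : ℝ≥0∞) = min (h p) n := fun p =>
          ENNReal.coe_toNNReal (ne_top_of_le_ne_top (ENNReal.natCast_ne_top n) (min_le_right _ _))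
        have hft : ∫⁻ p, ((min (h p) n).toNNReal : ℝ≥0∞) ∂(m : Measure E).prod (m : Measure E)
            ≠ ⊤ := by
          simp_rw [hcoe]
          exact ne_top_of_le_ne_top hfin (lintegral_mono fun p => min_le_left _ _)
        obtain ⟨g, hgf, hgusc, hgint⟩ := exists_upperSemicontinuous_le_lintegral_le _ hft
          (ε := ε / 2) (by simpa using hε.ne')
        simp_rw [hcoe] at hgint
        have hg' : ∀ p, (g p : ℝ≥0∞) ≤ min (h p) n := fun p =>
          (ENNReal.coe_le_coe.2 (hgf p)).trans_eq (hcoe p)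
        refine ⟨n, g, fun p => ?_, hgusc, fun p => (hg' p).trans (min_le_left _ _), ?_⟩
        · exact_mod_cast (hg' p).trans (min_le_right _ _)
        · calc I ≤ _ := hn
            _ ≤ _ := add_le_add_left hgint _
            _ = _ := by rw [add_assoc, ENNReal.add_halves]
      have hgm : Measurable fun p => (g p : ℝ≥0∞) := hgusc.measurable.coe_nnreal_ennreal
      have hrest : ∫⁻ p, h p - g p ∂(m : Measure E).prod (m : Measure E) ≤ ε := by
        have hgt : ∫⁻ p, g p ∂(m : Measure E).prod (m : Measure E) ≠ ⊤ :=
          ne_top_of_le_ne_top hfin (lintegral_mono hgh)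
        rw [lintegral_sub hgm hgt (Eventually.of_forall hgh)]
        exact tsub_le_iff_left.2 hgε
      refine le_trans ?_ ((mul_measure_exists_lt_pairSum_le (m : Measure E) (r := r)
        (hh.sub hgm)).trans hrest)
      gcongr r * ?_
      refine measure_mono_ae ?_
      filter_upwards [ae_tendsto_empirical m] with z hz hbad
      by_contra hgood
      have hgood : ∀ N, pairSum (fun p => h p - g p) N z
          ≤ r * ((Finset.range N).offDiag.card : ℝ≥0∞) :=
        fun N => not_lt.1 fun hN => hgood ⟨N, hN⟩
      refine hbad ?_
      let e : ℕ → ProbabilityMeasure E := fun N => empirical fun i : Fin (N + 1) => z i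
      have hee : Tendsto (fun N => (e N).prod (e N)) atTop (𝓝 (m.prod m)) :=
        (ProbabilityMeasure.continuous_prod.tendsto (m, m)).comp (hz.prodMk_nhds hz)
      have hV : ∀ N, V h N z
          ≤ ∫⁻ p, g p ∂((e N).prod (e N) : ProbabilityMeasure (E × E)) + r := by
        intro N
        have hsplit : pairSum h (N + 1) z
            = pairSum (fun p => (g p : ℝ≥0∞)) (N + 1) z
              + pairSum (fun p => h p - g p) (N + 1) z := by
          simp only [pairSum, ← Finset.sum_add_distrib, add_tsub_cancel_of_le (hgh _)]
        calc V h N z = (((N + 1 : ℕ) : ℝ≥0∞) ^ 2)⁻¹ * pairSum (fun p => (g p : ℝ≥0∞)) (N + 1) z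
              + (((N + 1 : ℕ) : ℝ≥0∞) ^ 2)⁻¹ * pairSum (fun p => h p - g p) (N + 1) z := by
              simp only [V, hsplit, mul_add]
          _ ≤ _ := by
            refine add_le_add (mul_pairSum_le_lintegral_empirical_prod z N hgm) ?_
            rw [← ENNReal.div_eq_inv_mul]
            refine ENNReal.div_le_of_le_mul ((hgood (N + 1)).trans ?_)
            gcongr
            rw [Finset.offDiag_card, Finset.card_range]
            exact_mod_cast (Nat.sub_le _ _).trans_eq (pow_two _).symm
      calc limsup (fun N => V h N z) atTop
          ≤ limsup (fun N =>
              ∫⁻ p, g p ∂((e N).prod (e N) : ProbabilityMeasure (E × E)) + r) atTop :=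
            limsup_le_limsup (Eventually.of_forall hV)
        _ = limsup (fun N =>
              ∫⁻ p, g p ∂((e N).prod (e N) : ProbabilityMeasure (E × E))) atTop + r :=
            limsup_add_const _ _ _ (by isBoundedDefault) (by isBoundedDefault)
        _ ≤ I + r := by
            gcongr
            exact (limsup_lintegral_le_of_upperSemicontinuous hee hgusc hgM).trans
              (lintegral_mono hgh)
    rw [nonpos_iff_eq_zero, mul_eq_zero, or_iff_right hr0] at hbound
    exact hbound
  have hseq : ∀ᵐ z ∂Q, ∀ k : ℕ, limsup (fun N => V h N z) atTop ≤ I + ((k + 1 : ℕ) : ℝ≥0∞)⁻¹ :=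
    ae_all_iff.2 fun k => main _ (by simp) (by simp)
  filter_upwards [hseq] with z hz
  have hlim : Tendsto (fun k : ℕ => I + ((k + 1 : ℕ) : ℝ≥0∞)⁻¹) atTop (𝓝 I) := by
    simpa using (tendsto_const_nhds (x := I)).add
      ((tendsto_add_atTop_iff_nat 1).2 ENNReal.tendsto_inv_nat_nhds_zero)
  exact ge_of_tendsto' hlim hz

end

/-! ### The potentials of the finite games -/

section Potentials

variable {X Y : Type*} [MeasurableSpace X] [MeasurableSpace Y]

theorem lintegral_snd_marginal (γ : ProbabilityMeasure (X × Y)) {g : Y → ℝ≥0∞}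
    (hg : Measurable g) :
    ∫⁻ y, g y ∂(γ.map measurable_snd.aemeasurable : ProbabilityMeasure Y)
      = ∫⁻ p, g p.2 ∂(γ : Measure (X × Y)) := by
  rw [ProbabilityMeasure.toMeasure_map, lintegral_map hg measurable_snd]

theorem planOfProfile_mem_plans {N : ℕ} [NeZero N] (x : Fin N → X)
    (ν : Fin N → ProbabilityMeasure Y) : planOfProfile x ν ∈ plans (empirical x) := by
  refine Subtype.ext (Measure.ext fun s hs => ?_)
  have hs' : Measurable (s.indicator (1 : X → ℝ≥0∞)) := measurable_one.indicator hs
  change (Measure.map Prod.fst (planOfProfile x ν : Measure (X × Y))) s = (empirical x : Measure X) s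
  rw [← lintegral_indicator_one hs, ← lintegral_indicator_one hs, lintegral_empirical x hs',
    lintegral_map hs' measurable_fst, lintegral_planOfProfile x ν (f := fun p => s.indicator 1 p.1) (hs'.comp measurable_fst)]
  simp

/-- A sample of type-strategy pairs is a profile of Dirac strategies. -/
theorem planOfProfile_kernelAt_snd {N : ℕ} [NeZero N] (z : Fin N → X × Y) :
    planOfProfile (fun i => (z i).1)
      (fun i => kernelAt (Kernel.deterministic (Prod.snd : X × Y → Y) measurable_snd) (z i))
      = empirical z := by
  apply Subtype.ext
  change (N : ℝ≥0∞)⁻¹ • ∑ i, (Measure.dirac (z i).1).prod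
    (Kernel.deterministic (Prod.snd : X × Y → Y) measurable_snd (z i))
      = (N : ℝ≥0∞)⁻¹ • ∑ i, Measure.dirac (z i)
  simp [Kernel.deterministic_apply, Measure.dirac_prod_dirac]

/-- The value which the mixed-strategy potential minimizes over the profiles inducing a plan: the
potential of the players of types `x` under the profile `ν` of mixed strategies. -/
noncomputable def profileCost (c : X × Y → ℝ≥0∞) (L : Y → ℝ≥0∞) (H : Y × Y → ℝ≥0∞)
    {N : ℕ} [NeZero N] (x : Fin N → X) (ν : Fin N → ProbabilityMeasure Y) : ℝ≥0∞ :=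
  ∫⁻ p, c p ∂(planOfProfile x ν : Measure (X × Y))
    + (N : ℝ≥0∞)⁻¹ * ∑ i, individualEnergy L (ν i)
    + ((N : ℝ≥0∞) ^ 2)⁻¹ *
        ∑ i, ∑ j ∈ Finset.univ.filter (· ≠ i), interactionEnergy H (ν i) (ν j)

variable {c : X × Y → ℝ≥0∞} {L : Y → ℝ≥0∞} {H : Y × Y → ℝ≥0∞}

theorem mixedPotential_planOfProfile_le {N : ℕ} [NeZero N] (x : Fin N → X)
    (ν : Fin N → ProbabilityMeasure Y) :
    mixedPotential c L H x (planOfProfile x ν) ≤ profileCost c L H x ν := by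
  rw [mixedPotential, if_pos (planOfProfile_mem_plans x ν)]
  exact iInf₂_le_of_le ν rfl le_rfl

theorem mixedPotential_le_purePotentialOnPlans {N : ℕ} [NeZero N] (x : Fin N → X)
    (γ : ProbabilityMeasure (X × Y)) :
    mixedPotential c L H x γ ≤ purePotentialOnPlans c L H x γ := by
  refine le_iInf₂ fun y hy => ?_
  rw [purePotential, hy]

theorem purePotentialOnPlans_empirical_le {N : ℕ} [NeZero N] (z : Fin N → X × Y) :
    purePotentialOnPlans c L H (fun i => (z i).1) (empirical z)
      ≤ profileCost c L H (fun i => (z i).1) (fun i =>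
        kernelAt (Kernel.deterministic (Prod.snd : X × Y → Y) measurable_snd) (z i)) := by
  refine iInf₂_le_of_le (fun i => (z i).2) rfl ?_
  rw [purePotential, ← planOfProfile_kernelAt_snd]
  exact mixedPotential_planOfProfile_le _ _

theorem limitPotential_of_mem {μ : ProbabilityMeasure X} {γ : ProbabilityMeasure (X × Y)}
    (hγ : γ ∈ plans μ) :
    limitPotential c L H μ γ = ∫⁻ p, c p ∂(γ : Measure (X × Y))
      + (individualEnergy L (γ.map measurable_snd.aemeasurable)
        + interactionEnergy H (γ.map measurable_snd.aemeasurable)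
            (γ.map measurable_snd.aemeasurable)) := if_pos hγ

theorem interactionEnergy_snd_marginal_planOfProfile {N : ℕ} [NeZero N] (x : Fin N → X)
    (ν : Fin N → ProbabilityMeasure Y) (hH : Measurable H) :
    interactionEnergy H ((planOfProfile x ν).map measurable_snd.aemeasurable)
        ((planOfProfile x ν).map measurable_snd.aemeasurable)
      = ((N : ℝ≥0∞) ^ 2)⁻¹ * ∑ i, ∑ j, interactionEnergy H (ν i) (ν j) := by
  have hN0 : (N : ℝ≥0∞) ≠ 0 := Nat.cast_ne_zero.2 (NeZero.ne N)
  have hmarg : ∀ g : Y → ℝ≥0∞, Measurable g →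
      ∫⁻ y, g y ∂((planOfProfile x ν).map measurable_snd.aemeasurable : ProbabilityMeasure Y)
        = (N : ℝ≥0∞)⁻¹ * ∑ i, ∫⁻ y, g y ∂(ν i : Measure Y) := fun g hg => by
    rw [lintegral_snd_marginal _ hg,
      lintegral_planOfProfile x ν (f := fun p => g p.2) (hg.comp measurable_snd)]
  have hpart : ∀ j, Measurable fun y => ∫⁻ y', H (y, y') ∂(ν j : Measure Y) := fun j =>
    hH.lintegral_prod_right'
  rw [interactionEnergy, lintegral_prod _ hH.aemeasurable, hmarg _ hH.lintegral_prod_right']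
  have hinner : ∀ y, ∫⁻ y', H (y, y')
      ∂((planOfProfile x ν).map measurable_snd.aemeasurable : ProbabilityMeasure Y)
      = (N : ℝ≥0∞)⁻¹ * ∑ j, ∫⁻ y', H (y, y') ∂(ν j : Measure Y) := fun y =>
    hmarg _ (hH.comp measurable_prodMk_left)
  simp_rw [hinner]
  have houter : ∀ i, ∫⁻ y, (N : ℝ≥0∞)⁻¹ * ∑ j, ∫⁻ y', H (y, y') ∂(ν j : Measure Y)
      ∂(ν i : Measure Y) = (N : ℝ≥0∞)⁻¹ * ∑ j, interactionEnergy H (ν i) (ν j) := by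
    intro i
    rw [lintegral_const_mul _ (Finset.measurable_fun_sum _ fun j _ => hpart j),
      lintegral_finsetSum _ fun j _ => hpart j]
    simp_rw [interactionEnergy, lintegral_prod _ hH.aemeasurable]
  simp_rw [houter]
  rw [← Finset.mul_sum, ← mul_assoc, pow_two,
    ENNReal.mul_inv (Or.inl hN0) (Or.inl (ENNReal.natCast_ne_top N))]

/-- Truncating the interaction at level `M` restores the diagonal terms, missing in the finite
game, at a total cost of at most `N⁻² * N * M`. -/
theorem truncated_le_mixedPotential_add {N : ℕ} [NeZero N] (x : Fin N → X)
    (γ : ProbabilityMeasure (X × Y)) (hL : Measurable L) (hH : Measurable H) (M : ℕ) :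
    ∫⁻ p, c p ∂(γ : Measure (X × Y))
      + (individualEnergy L (γ.map measurable_snd.aemeasurable)
        + interactionEnergy (fun p => min (H p) M) (γ.map measurable_snd.aemeasurable)
            (γ.map measurable_snd.aemeasurable))
      ≤ mixedPotential c L H x γ + M * (N : ℝ≥0∞)⁻¹ := by
  have hN0 : (N : ℝ≥0∞) ≠ 0 := Nat.cast_ne_zero.2 (NeZero.ne N)
  have hNt : (N : ℝ≥0∞) ≠ ⊤ := ENNReal.natCast_ne_top N
  rw [mixedPotential]
  split_ifs with hγ
  swap
  · simp
  simp_rw [ENNReal.iInf_add]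
  refine le_iInf₂ fun ν hν => ?_
  subst hν
  have hLν : individualEnergy L ((planOfProfile x ν).map measurable_snd.aemeasurable)
      = (N : ℝ≥0∞)⁻¹ * ∑ i, individualEnergy L (ν i) := by
    rw [individualEnergy, lintegral_snd_marginal _ hL,
      lintegral_planOfProfile x ν (f := fun p => L p.2) (hL.comp measurable_snd)]
    rfl
  have hterm : ∀ i, ∑ j, interactionEnergy (fun p => min (H p) M) (ν i) (ν j)
      ≤ ∑ j ∈ Finset.univ.filter (· ≠ i), interactionEnergy H (ν i) (ν j) + M := by
    intro i
    rw [← Finset.sum_filter_add_sum_filter_not Finset.univ (· ≠ i)]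
    gcongr with j
    · exact lintegral_mono fun p => min_le_left _ _
    · simp only [ne_eq, not_not, Finset.filter_eq', Finset.mem_univ, if_true, Finset.sum_singleton]
      calc interactionEnergy (fun p => min (H p) M) (ν i) (ν i)
          ≤ ∫⁻ _, (M : ℝ≥0∞) ∂((ν i : Measure Y).prod (ν i : Measure Y)) :=
            lintegral_mono fun p => min_le_right _ _
        _ = M := by simp
  rw [interactionEnergy_snd_marginal_planOfProfile x ν (hH.min measurable_const), hLν,
    add_assoc (_ + _), add_assoc]
  gcongr
  calc ((N : ℝ≥0∞) ^ 2)⁻¹ * ∑ i, ∑ j, interactionEnergy (fun p => min (H p) M) (ν i) (ν j)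
      ≤ ((N : ℝ≥0∞) ^ 2)⁻¹ * ∑ i,
          (∑ j ∈ Finset.univ.filter (· ≠ i), interactionEnergy H (ν i) (ν j) + M) := by
        gcongr with i
        exact hterm i
    _ = _ := by
        rw [Finset.sum_add_distrib, mul_add]
        congr 1
        rw [Finset.sum_const, Finset.card_univ, Fintype.card_fin, nsmul_eq_mul, pow_two,
          ENNReal.mul_inv (Or.inl hN0) (Or.inl hNt), mul_assoc, ← mul_assoc _ (N : ℝ≥0∞),
          ENNReal.inv_mul_cancel hN0 hNt, one_mul, mul_comm]

end Potentials

/-! ### The liminf inequality -/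

section LowerBound

variable {X Y : Type*} [TopologicalSpace X] [PolishSpace X] [MeasurableSpace X] [BorelSpace X]
  [TopologicalSpace Y] [PolishSpace Y] [MeasurableSpace Y] [BorelSpace Y]

/-- The liminf inequality holds along every sequence of types whose empirical measures converge
to `μ`. With the interaction truncated at level `M`, the limit potential is lower semicontinuous and
exceeds the potential of the finite game by at most `M / N`; then `M` tends to infinity. A limit
outside `plans μ` forces the plans to leave `plans μ_N`, by continuity of the first marginal. -/
theorem limitPotential_le_liminf_mixedPotential {c : X × Y → ℝ≥0∞} {L : Y → ℝ≥0∞}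
    {H : Y × Y → ℝ≥0∞} (hc : LowerSemicontinuous c) (hL : LowerSemicontinuous L)
    (hH : LowerSemicontinuous H) {μ : ProbabilityMeasure X} {x : ℕ → X}
    (hx : Tendsto (fun N => empirical fun i : Fin (N + 1) => x i) atTop (𝓝 μ))
    {γ : ProbabilityMeasure (X × Y)} {γs : ℕ → ProbabilityMeasure (X × Y)}
    (hγ : Tendsto γs atTop (𝓝 γ)) :
    limitPotential c L H μ γ
      ≤ liminf (fun N => mixedPotential c L H (fun i : Fin (N + 1) => x i) (γs N)) atTop := by
  by_cases hmem : γ ∈ plans μ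
  · let Λ : ℕ → ProbabilityMeasure (X × Y) → ℝ≥0∞ := fun M η =>
      ∫⁻ p, c p ∂(η : Measure (X × Y))
        + (individualEnergy L (η.map measurable_snd.aemeasurable)
          + interactionEnergy (fun p => min (H p) M) (η.map measurable_snd.aemeasurable)
              (η.map measurable_snd.aemeasurable))
    have hΛ : ∀ M, LowerSemicontinuous (Λ M) := by
      intro M
      have hsnd : Continuous fun η : ProbabilityMeasure (X × Y) =>
          η.map measurable_snd.aemeasurable :=
        ProbabilityMeasure.continuous_map continuous_snd
      refine (lowerSemicontinuous_lintegral hc).add (LowerSemicontinuous.add ?_ ?_)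
      · exact (lowerSemicontinuous_lintegral hL).comp hsnd
      · exact (lowerSemicontinuous_lintegral
          (hH.inf lowerSemicontinuous_const)).comp
            (ProbabilityMeasure.continuous_prod.comp (hsnd.prodMk hsnd))
    have hsup : limitPotential c L H μ γ = ⨆ M, Λ M γ := by
      rw [limitPotential_of_mem hmem, interactionEnergy,
        lintegral_eq_iSup_lintegral_min hH.measurable, ENNReal.add_iSup, ENNReal.add_iSup]
      rfl
    rw [hsup]
    refine iSup_le fun M => ?_
    have herr : Tendsto (fun N : ℕ => (M : ℝ≥0∞) * ((N + 1 : ℕ) : ℝ≥0∞)⁻¹) atTop (𝓝 0) := by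
      simpa using ENNReal.Tendsto.const_mul ((tendsto_add_atTop_iff_nat 1).2
        ENNReal.tendsto_inv_nat_nhds_zero) (Or.inr (ENNReal.natCast_ne_top M))
    rw [← ENNReal.liminf_add_of_right_tendsto_zero herr]
    calc Λ M γ ≤ liminf (fun N => Λ M (γs N)) atTop :=
          ((hΛ M).le_liminf γ).trans (liminf_le_liminf_of_le hγ)
      _ ≤ _ := liminf_le_liminf (Eventually.of_forall fun N =>
          truncated_le_mixedPotential_add _ _ hL.measurable hH.measurable M)
  · have hev : ∀ᶠ N in atTop, γs N ∉ plans (empirical fun i : Fin (N + 1) => x i) := by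
      by_contra hfreq
      rw [not_eventually] at hfreq
      refine hmem (tendsto_nhds_unique_of_frequently_eq
        (((ProbabilityMeasure.continuous_map continuous_fst).tendsto γ).comp hγ) hx
        (hfreq.mono fun N hN => not_not.1 hN))
    have htop : liminf (fun N => mixedPotential c L H (fun i : Fin (N + 1) => x i) (γs N)) atTop
        = ⊤ := by
      have hev' : ∀ᶠ N in atTop,
          mixedPotential c L H (fun i : Fin (N + 1) => x i) (γs N) = ⊤ :=
        hev.mono fun N hN => if_neg hN
      rw [liminf_congr hev', liminf_const]
    rw [htop]
    exact le_top

end LowerBound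

/-! ### Recovery sequences from random samples -/

section Recovery

theorem limsup_add_le_of_tendsto {ι : Type*} {l : Filter ι} [l.NeBot] {u v : ι → ℝ≥0∞}
    {a b : ℝ≥0∞} (ha : a ≠ ⊤) (hu : Tendsto u l (𝓝 a)) (hv : limsup v l ≤ b) :
    limsup (fun i => u i + v i) l ≤ a + b := by
  refine ENNReal.le_of_forall_pos_le_add fun ε hε _ => ?_
  have hev : ∀ᶠ i in l, u i < a + ε :=
    hu.eventually_lt_const (ENNReal.lt_add_right ha (by simpa using hε.ne'))
  calc limsup (fun i => u i + v i) l ≤ limsup (fun i => (a + ε) + v i) l :=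
        limsup_le_limsup (hev.mono fun i hi => add_le_add hi.le le_rfl)
    _ = a + ε + limsup v l :=
        limsup_const_add _ _ _ (by isBoundedDefault) (by isBoundedDefault)
    _ ≤ a + b + ε := by
        rw [add_right_comm]
        gcongr

theorem sum_sum_ne_eq_sum_offDiag {R : Type*} [AddCommMonoid R] (n : ℕ) (f : ℕ → ℕ → R) :
    ∑ i : Fin n, ∑ j ∈ Finset.univ.filter (· ≠ i), f i j
      = ∑ p ∈ (Finset.range n).offDiag, f p.1 p.2 := by
  have : (Finset.range n).offDiag
      = (Finset.range n ×ˢ Finset.range n).filter fun p => p.2 ≠ p.1 := by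
    ext p
    simp [Finset.mem_offDiag, and_assoc, ne_comm]
  rw [this, Finset.sum_filter, Finset.sum_product, Finset.sum_range]
  simp only [Finset.sum_filter, Finset.sum_range, ne_eq, Fin.ext_iff]

variable {X Y E : Type*} [TopologicalSpace X] [PolishSpace X] [MeasurableSpace X] [BorelSpace X]
  [TopologicalSpace Y] [PolishSpace Y] [MeasurableSpace Y] [BorelSpace Y]
  [TopologicalSpace E] [PolishSpace E] [MeasurableSpace E] [BorelSpace E]

/-- Sampling a plan: the players are drawn independently with law `m`, player `e` has type `t e` and
plays the mixed strategy `κ e`. Taking `e` to be the type gives mixed strategies from a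
disintegration; taking `e` to be a pair (type, strategy) and `κ` deterministic gives pure strategies.
The interaction is a `U`-statistic with kernel `∫ H d(κ e ⊗ κ e')`. -/
theorem ae_tendsto_planOfProfile_and_limsup_profileCost_le
    {c : X × Y → ℝ≥0∞} {L : Y → ℝ≥0∞} {H : Y × Y → ℝ≥0∞}
    (hc : Measurable c) (hL : Measurable L) (hH : Measurable H)
    (m : ProbabilityMeasure E) {t : E → X} (ht : Measurable t)
    (κ : Kernel E Y) [IsMarkovKernel κ] {γ : ProbabilityMeasure (X × Y)}
    (hγ : ∀ f : X × Y → ℝ≥0∞, Measurable f →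
      ∫⁻ p, f p ∂(γ : Measure (X × Y)) = ∫⁻ e, ∫⁻ y, f (t e, y) ∂κ e ∂(m : Measure E)) :
    ∀ᵐ z ∂Measure.infinitePi (fun _ : ℕ => (m : Measure E)),
      Tendsto (fun N => planOfProfile (fun i : Fin (N + 1) => t (z i))
          fun i => kernelAt κ (z i)) atTop (𝓝 γ) ∧
      limsup (fun N => profileCost c L H (fun i : Fin (N + 1) => t (z i))
          fun i => kernelAt κ (z i)) atTop
        ≤ ∫⁻ p, c p ∂(γ : Measure (X × Y))
          + (individualEnergy L (γ.map measurable_snd.aemeasurable)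
            + interactionEnergy H (γ.map measurable_snd.aemeasurable)
                (γ.map measurable_snd.aemeasurable)) := by
  set Q := Measure.infinitePi fun _ : ℕ => (m : Measure E)
  have hmeas : ∀ {f : X × Y → ℝ≥0∞}, Measurable f →
      Measurable fun e => ∫⁻ y, f (t e, y) ∂κ e := fun hf =>
    Measurable.lintegral_kernel_prod_right' (f := fun q : E × Y => _)
      (hf.comp ((ht.comp measurable_fst).prodMk measurable_snd))
  have hlln : ∀ f : X × Y → ℝ≥0∞, Measurable f → ∫⁻ p, f p ∂(γ : Measure (X × Y)) ≠ ⊤ →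
      ∀ᵐ z ∂Q, Tendsto (fun N => ∫⁻ p, f p ∂(planOfProfile (fun i : Fin (N + 1) => t (z i))
        fun i => kernelAt κ (z i) : Measure (X × Y))) atTop
        (𝓝 (∫⁻ p, f p ∂(γ : Measure (X × Y)))) := by
    intro f hf hfin
    rw [hγ f hf] at hfin ⊢
    filter_upwards [ae_tendsto_average (m : Measure E) (hmeas hf) hfin] with z hz
    simp_rw [lintegral_planOfProfile _ _ hf]
    exact hz
  have hconv : ∀ᵐ z ∂Q, Tendsto (fun N => planOfProfile (fun i : Fin (N + 1) => t (z i))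
      fun i => kernelAt κ (z i)) atTop (𝓝 γ) := by
    refine ae_tendsto_of_forall_ae_tendsto_measure fun s hs => ?_
    have := hlln (s.indicator 1) (measurable_one.indicator hs) (by
      rw [lintegral_indicator_one hs]
      exact measure_ne_top _ _)
    simpa only [lintegral_indicator_one hs] using this
  refine hconv.and ?_
  have hL' : individualEnergy L (γ.map measurable_snd.aemeasurable)
      = ∫⁻ p, L p.2 ∂(γ : Measure (X × Y)) := lintegral_snd_marginal γ hL
  have hHm : Measurable fun q : E × E => ∫⁻ p, H p ∂((κ q.1).prod (κ q.2)) := by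
    simpa only [Kernel.parallelComp_apply] using hH.lintegral_kernel (κ := κ ∥ₖ κ)
  have hH' : ∫⁻ q, ∫⁻ p, H p ∂((κ q.1).prod (κ q.2)) ∂(m : Measure E).prod (m : Measure E)
      = interactionEnergy H (γ.map measurable_snd.aemeasurable)
        (γ.map measurable_snd.aemeasurable) := by
    have hmarg : ∀ g : Y → ℝ≥0∞, Measurable g →
        ∫⁻ y, g y ∂(γ.map measurable_snd.aemeasurable : ProbabilityMeasure Y)
          = ∫⁻ e, ∫⁻ y, g y ∂κ e ∂(m : Measure E) := fun g hg => by
      rw [lintegral_snd_marginal _ hg, hγ (fun p => g p.2) (hg.comp measurable_snd)]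
    have hinner : ∀ y, ∫⁻ y', H (y, y')
        ∂(γ.map measurable_snd.aemeasurable : ProbabilityMeasure Y)
        = ∫⁻ e', ∫⁻ y', H (y, y') ∂κ e' ∂(m : Measure E) := fun y =>
      hmarg _ (hH.comp measurable_prodMk_left)
    have hpart : Measurable fun q : Y × E => ∫⁻ y', H (q.1, y') ∂κ q.2 :=
      Measurable.lintegral_kernel_prod_right' (κ := Kernel.prodMkLeft Y κ)
        (f := fun q : (Y × E) × Y => H (q.1.1, q.2))
        (hH.comp ((measurable_fst.comp measurable_fst).prodMk measurable_snd))
    rw [interactionEnergy, lintegral_prod _ hH.aemeasurable, hmarg _ hH.lintegral_prod_right',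
      lintegral_prod _ hHm.aemeasurable]
    simp_rw [hinner, lintegral_prod _ hH.aemeasurable]
    refine lintegral_congr fun e => ?_
    exact (lintegral_lintegral_swap hpart.aemeasurable).symm
  by_cases hcfin : ∫⁻ p, c p ∂(γ : Measure (X × Y)) = ⊤
  · simp [hcfin]
  by_cases hLfin : ∫⁻ p, L p.2 ∂(γ : Measure (X × Y)) = ⊤
  · simp [hL', hLfin]
  filter_upwards [hlln c hc hcfin, hlln (fun p => L p.2) (hL.comp measurable_snd) hLfin,
    ae_limsup_pairSum_le m hHm] with z hzc hzL hzH
  rw [hL', ← add_assoc, ← hH']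
  refine limsup_add_le_of_tendsto (ENNReal.add_ne_top.2 ⟨hcfin, hLfin⟩) (hzc.add ?_) ?_
  · refine hzL.congr fun N => ?_
    exact lintegral_planOfProfile _ _ (hL.comp measurable_snd)
  · refine le_of_eq_of_le (limsup_congr (Eventually.of_forall fun N => ?_)) hzH
    rw [pairSum, ← sum_sum_ne_eq_sum_offDiag (N + 1)
      fun i j => ∫⁻ p, H p ∂((κ (z i)).prod (κ (z j)))]
    rfl

end Recovery

/-! ### Almost sure `Γ`-convergence -/

section Fibres

/-- A property of almost every i.i.d. sample of pairs holds, for almost every sample of the first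
components, for some second components: disintegrate the law of the pair of sequences with respect
to the first one. -/
theorem ae_exists_of_ae_infinitePi {X Y : Type*} [MeasurableSpace X]
    [TopologicalSpace Y] [PolishSpace Y] [MeasurableSpace Y] [BorelSpace Y]
    {μ : ProbabilityMeasure X} {γ : ProbabilityMeasure (X × Y)} (hγ : γ ∈ plans μ)
    {p : (ℕ → X) → (ℕ → Y) → Prop}
    (h : ∀ᵐ z ∂Measure.infinitePi (fun _ : ℕ => (γ : Measure (X × Y))),
      p (fun i => (z i).1) (fun i => (z i).2)) :
    ∀ᵐ x ∂Measure.infinitePi (fun _ : ℕ => (μ : Measure X)), ∃ y, p x y := by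
  have hγμ : (γ : Measure (X × Y)).map Prod.fst = μ := congrArg Subtype.val hγ
  have : Nonempty (X × Y) := nonempty_of_isProbabilityMeasure (γ : Measure (X × Y))
  have : Nonempty Y := this.map Prod.snd
  let e : (ℕ → X × Y) ≃ᵐ (ℕ → X) × (ℕ → Y) := MeasurableEquiv.arrowProdEquivProdArrow X Y ℕ
  let ρ := (Measure.infinitePi fun _ : ℕ => (γ : Measure (X × Y))).map e
  have : IsProbabilityMeasure ρ := Measure.isProbabilityMeasure_map e.measurable.aemeasurable
  have hfst : ρ.fst = Measure.infinitePi fun _ : ℕ => (μ : Measure X) := by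
    rw [Measure.fst, Measure.map_map measurable_fst e.measurable]
    have := Measure.infinitePi_map_pi (fun _ : ℕ => (γ : Measure (X × Y)))
      (f := fun _ => Prod.fst) fun _ => measurable_fst
    simp only [hγμ] at this
    exact this
  have hρ : ∀ᵐ q ∂ρ, p q.1 q.2 := (e.measurableEmbedding.ae_map_iff).2 h
  rw [← ρ.disintegrate ρ.condKernel] at hρ
  have := Measure.ae_ae_of_ae_compProd hρ
  rw [hfst] at this
  exact this.mono fun x hx => hx.exists

end Fibres

section

variable {X Y : Type*} [TopologicalSpace X] [PolishSpace X] [MeasurableSpace X] [BorelSpace X]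
  [TopologicalSpace Y] [PolishSpace Y] [MeasurableSpace Y] [BorelSpace Y]
  {c : X × Y → ℝ≥0∞} {L : Y → ℝ≥0∞} {H : Y × Y → ℝ≥0∞} {μ : ProbabilityMeasure X}
  {γ : ProbabilityMeasure (X × Y)}

theorem ae_isRecoverySequence_mixed (hc : Measurable c) (hL : Measurable L) (hH : Measurable H)
    (hγ : γ ∈ plans μ) (ν : Kernel X Y) [IsMarkovKernel ν]
    (hν : (μ : Measure X).compProd ν = (γ : Measure (X × Y))) :
    ∀ᵐ x ∂Measure.infinitePi (fun _ : ℕ => (μ : Measure X)),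
      IsRecoverySequence (fun N => mixedPotential c L H (fun i : Fin (N + 1) => x i))
        (limitPotential c L H μ) γ
        (fun N => planOfProfile (fun i : Fin (N + 1) => x i) fun i => kernelAt ν (x i)) := by
  have hγν : ∀ f : X × Y → ℝ≥0∞, Measurable f →
      ∫⁻ p, f p ∂(γ : Measure (X × Y)) = ∫⁻ x, ∫⁻ y, f (x, y) ∂ν x ∂(μ : Measure X) :=
    fun f hf => by rw [← hν, Measure.lintegral_compProd hf]
  filter_upwards [ae_tendsto_planOfProfile_and_limsup_profileCost_le hc hL hH μ measurable_id ν hγν]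
    with x hx
  refine ⟨hx.1, ?_⟩
  rw [limitPotential_of_mem hγ]
  exact (limsup_le_limsup (Eventually.of_forall fun N =>
    mixedPotential_planOfProfile_le _ _)).trans hx.2

theorem ae_isRecoverySequence_pure (hc : Measurable c) (hL : Measurable L) (hH : Measurable H)
    (hγ : γ ∈ plans μ) :
    ∀ᵐ z ∂Measure.infinitePi (fun _ : ℕ => (γ : Measure (X × Y))),
      IsRecoverySequence (fun N => purePotentialOnPlans c L H (fun i : Fin (N + 1) => (z i).1))
        (limitPotential c L H μ) γ (fun N => empirical fun i : Fin (N + 1) => z i) := by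
  let κ : Kernel (X × Y) Y := Kernel.deterministic Prod.snd measurable_snd
  have hγκ : ∀ f : X × Y → ℝ≥0∞, Measurable f →
      ∫⁻ p, f p ∂(γ : Measure (X × Y)) = ∫⁻ e, ∫⁻ y, f (e.1, y) ∂κ e ∂(γ : Measure (X × Y)) := by
    intro f hf
    simp only [κ, Kernel.deterministic_apply]
    refine lintegral_congr fun e => ?_
    exact (lintegral_dirac' e.2 (f := fun y => f (e.1, y))
      (hf.comp measurable_prodMk_left)).symm
  filter_upwards [ae_tendsto_planOfProfile_and_limsup_profileCost_le hc hL hH γ measurable_fst κ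
    hγκ] with z hz
  refine ⟨hz.1.congr fun N => planOfProfile_kernelAt_snd _, ?_⟩
  rw [limitPotential_of_mem hγ]
  exact (limsup_le_limsup (Eventually.of_forall fun N =>
    purePotentialOnPlans_empirical_le _)).trans hz.2

/-- The types alone carry no randomness for the strategies; these are provided by
`ae_exists_of_ae_infinitePi`. -/
theorem ae_exists_isRecoverySequence_pure (hc : Measurable c) (hL : Measurable L)
    (hH : Measurable H) (hγ : limitPotential c L H μ γ < ⊤) :
    ∀ᵐ x ∂Measure.infinitePi (fun _ : ℕ => (μ : Measure X)), ∃ u,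
      IsRecoverySequence (fun N => purePotentialOnPlans c L H (fun i : Fin (N + 1) => x i))
        (limitPotential c L H μ) γ u := by
  have hmem : γ ∈ plans μ := by
    by_contra hmem
    exact hγ.ne (if_neg hmem)
  filter_upwards [ae_exists_of_ae_infinitePi (p := fun x y => IsRecoverySequence
    (fun N => purePotentialOnPlans c L H (fun i : Fin (N + 1) => x i)) (limitPotential c L H μ) γ
    (fun N => empirical fun i : Fin (N + 1) => (x i, y i))) hmem
    (ae_isRecoverySequence_pure hc hL hH hmem)] with x ⟨y, hy⟩
  exact ⟨_, hy⟩

theorem ae_gammaConverges (hc : LowerSemicontinuous c) (hL : LowerSemicontinuous L)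
    (hH : LowerSemicontinuous H) :
    ∀ᵐ x ∂Measure.infinitePi (fun _ : ℕ => (μ : Measure X)),
      GammaConverges (fun N => mixedPotential c L H (fun i : Fin (N + 1) => x i))
        (limitPotential c L H μ) ∧
      GammaConverges (fun N => purePotentialOnPlans c L H (fun i : Fin (N + 1) => x i))
        (limitPotential c L H μ) := by
  filter_upwards [ae_tendsto_empirical μ, ae_forall_exists_isRecoverySequence fun γ hγ =>
    ae_exists_isRecoverySequence_pure (μ := μ) (γ := γ) hc.measurable hL.measurable hH.measurable
      hγ] with x hx hrec
  have hlower : ∀ (γ : ProbabilityMeasure (X × Y)) (γs : ℕ → ProbabilityMeasure (X × Y)),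
      Tendsto γs atTop (𝓝 γ) → limitPotential c L H μ γ
        ≤ liminf (fun N => mixedPotential c L H (fun i : Fin (N + 1) => x i) (γs N)) atTop :=
    fun γ γs hγ => limitPotential_le_liminf_mixedPotential hc hL hH hx hγ
  refine ⟨⟨hlower, fun γ => ?_⟩, fun γ γs hγ => ?_, hrec⟩
  · obtain ⟨u, hu, hu'⟩ := hrec γ
    exact ⟨u, hu, (limsup_le_limsup (Eventually.of_forall fun N =>
      mixedPotential_le_purePotentialOnPlans _ _)).trans hu'⟩
  · exact (hlower γ γs hγ).trans (liminf_le_liminf (Eventually.of_forall fun N =>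
      mixedPotential_le_purePotentialOnPlans _ _))

end

/-- Almost sure properties of an i.i.d. sequence may be checked on the sequence space. -/
theorem ae_of_ae_infinitePi {Ω E : Type*} [MeasurableSpace Ω] [MeasurableSpace E] {P : Measure Ω}
    {m : Measure E} {Z : ℕ → Ω → E} (hZ : ∀ i, Measurable (Z i)) (hind : iIndepFun Z P)
    (hlaw : ∀ i, P.map (Z i) = m) {p : (ℕ → E) → Prop}
    (h : ∀ᵐ z ∂Measure.infinitePi (fun _ : ℕ => m), p z) : ∀ᵐ ω ∂P, p fun i => Z i ω := by
  have hmap := hind.map_fun_eq_infinitePi_map hZ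
  simp only [hlaw] at hmap
  rw [← hmap] at h
  exact ae_of_ae_map (measurable_pi_lambda _ hZ).aemeasurable h

end CournotNash

/-- The `N`-th term of each sequence below is the game with the `N + 1` players
`X 0, …, X N`. -/
theorem theorem4p9
    {Ω X Y : Type*}
    [TopologicalSpace X] [PolishSpace X] [MeasurableSpace X] [BorelSpace X]
    [TopologicalSpace Y] [PolishSpace Y] [MeasurableSpace Y] [BorelSpace Y]
    [MeasurableSpace Ω] (P : Measure Ω) [IsProbabilityMeasure P]
    (μ : ProbabilityMeasure X) (hμ : ∀ x : X, (μ : Measure X) {x} = 0)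
    (c : X × Y → ℝ≥0∞) (L : Y → ℝ≥0∞) (H : Y × Y → ℝ≥0∞)
    (hc : LowerSemicontinuous c) (hL : LowerSemicontinuous L) (hH : LowerSemicontinuous H)
    (hH_symm : ∀ y y' : Y, H (y, y') = H (y', y))
    (hL_compact : ∀ κ : ℝ, 0 < κ → IsCompact {y : Y | L y ≤ ENNReal.ofReal κ})
    (T : ℕ → Ω → X) (hT_meas : ∀ i, Measurable (T i))
    (hT_indep : iIndepFun T P) (hT_law : ∀ i, P.map (T i) = (μ : Measure X)) :
    -- almost sure `Γ`-convergence of both potentials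
    (∀ᵐ ω ∂P,
      CournotNash.GammaConverges
        (fun N => CournotNash.mixedPotential c L H (fun i : Fin (N + 1) => T i ω))
        (CournotNash.limitPotential c L H μ) ∧
      CournotNash.GammaConverges
        (fun N => CournotNash.purePotentialOnPlans c L H (fun i : Fin (N + 1) => T i ω))
        (CournotNash.limitPotential c L H μ)) ∧
    -- recovery sequences in mixed strategies, from a disintegration of the plan
    (∀ γ ∈ (CournotNash.plans μ : Set (ProbabilityMeasure (X × Y))),
      ∀ (ν : Kernel X Y) [IsMarkovKernel ν],
        (μ : Measure X).compProd ν = (γ : Measure (X × Y)) →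
        ∀ᵐ ω ∂P, CournotNash.IsRecoverySequence
          (fun N => CournotNash.mixedPotential c L H (fun i : Fin (N + 1) => T i ω))
          (CournotNash.limitPotential c L H μ) γ
          (fun N => CournotNash.planOfProfile (fun i : Fin (N + 1) => T i ω)
            (fun i => CournotNash.kernelAt ν (T i ω)))) ∧
    -- recovery sequences in pure strategies, from an i.i.d. coupling with law the plan
    (∀ γ ∈ (CournotNash.plans μ : Set (ProbabilityMeasure (X × Y))),
      ∀ S : ℕ → Ω → Y, (∀ i, Measurable (S i)) →
        iIndepFun (fun i ω => (T i ω, S i ω)) P →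
        (∀ i, P.map (fun ω => (T i ω, S i ω)) = (γ : Measure (X × Y))) →
        ∀ᵐ ω ∂P, CournotNash.IsRecoverySequence
          (fun N => CournotNash.purePotentialOnPlans c L H (fun i : Fin (N + 1) => T i ω))
          (CournotNash.limitPotential c L H μ) γ
          (fun N => CournotNash.empirical (fun i : Fin (N + 1) => (T i ω, S i ω)))) := by
  refine ⟨?_, fun γ hγ ν _ hν => ?_, fun γ hγ S hS hTS hlaw => ?_⟩
  · exact CournotNash.ae_of_ae_infinitePi hT_meas hT_indep hT_law
      (CournotNash.ae_gammaConverges hc hL hH)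
  · exact CournotNash.ae_of_ae_infinitePi hT_meas hT_indep hT_law
      (CournotNash.ae_isRecoverySequence_mixed hc.measurable hL.measurable hH.measurable hγ ν hν)
  · exact CournotNash.ae_of_ae_infinitePi (fun i => (hT_meas i).prodMk (hS i)) hTS hlaw
      (CournotNash.ae_isRecoverySequence_pure hc.measurable hL.measurable hH.measurable hγ)
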